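/- Let $d,m$ be natural numbers. A function $\mathbf C:\mathbb R^d\to\mathbb R^{m\times m}$ is called \emph{positive definite} if $C_{ij}(\mathbf h)=C_{ji}(-\mathbf h)$ for all $\mathbf h,i,j$ and $\sum_{k=1}^n\sum_{l=1}^n \mathbf a_k^\top \mathbf C(\mathbf x_k-\mathbf x_l)\mathbf a_l\ge 0$ for all $n\in\mathbb N$, $\mathbf x_1,\dots,\mathbf x_n\in\mathbb R^d$, $\mathbf a_1,\dots,\mathbf a_n\in\mathbb R^m$. It is called \emph{infinitely divisible} if it is positive definite and for each integer $n\ge1$ there is a positive definite $\mathbf C_n:\mathbb R^d\to\mathbb R^{m\times m}$ whose componentwise $n$-th power is $\mathbf C$. Let $\boldsymbol\gamma:\mathbb R^d\to\mathbb R^{m\times m}$ be a pseudo cross-variogram, i.e. there is an $m$-variate real random field $Z$ on $\mathbb R^d$ such that $Z_i(\mathbf x)-Z_j(\mathbf y)$ is square integrable for all $\mathbf x,\mathbf y\in\mathbb R^d$, $i,j=1,\dots,m$, and $$\gamma_{ij}(\mathbf h)=\tfrac12\operatorname{Var}\bigl(Z_i(\mathbf x+\mathbf h)-Z_j(\mathbf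 x)\bigr)\quad\text{for all }\mathbf x,\mathbf h\in\mathbb R^d,\ i,j=1,\dots,m.$$ Let $f$ be an entire function taking real values on the reals such that (i) $f(0)>0$ and $f'(0)=0$; (ii) all zeros of $f$ are purely imaginary; (iii) the order $\rho=\limsup_{r\to\infty}\frac{\log\log M(r)}{\log r}$ of $f$, where $M(r)=\max\{|f(z)|:|z|=r\}$, is less than $2$ (the order of a constant function being $0$). Then $f(\sqrt{\gamma_{ij}(\mathbf h)})\neq0$ for all $\mathbf h,i,j$, and for every $\nu\in[0,1]$ the function $\mathbf C:\mathbb R^d\to\mathbb R^{m\times m}$, $$C_{ij}(\mathbf h)=\frac{f\bigl(\nu\sqrt{\gamma_{ij}(\mathbf h)}\bigr)}{f\bigl(\sqrt{\gamma_{ij}(\mathbf h)}\bigr)},\quad i,j=1,\dots,m,$$ is infinitely divisible. In particular, $f=\cosh$ satisfies these conditions, so that $C_{ij}(\mathbf h)=\cosh\bigl(\nu\sqrt{\gamma_{ij}(\mathbf h)}\bigr)/\cosh\bigl(\sqrt{\gamma_{ij}(\mathbf h)}\bigr)$ is infinitely divisible for every $\nu\in[0,1]$. -/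

import Mathlib

open MeasureTheory ProbabilityTheory Filter

/-- The kernel `C(x, y)` is a positive definite matrix-valued kernel on `ℝ^d`:
`C_ij(x, y) = C_ji(y, x)` and `∑ k, ∑ l, a_kᵀ C(x_k, x_l) a_l ≥ 0` for all finite families of
points and real vectors. -/
def IsPosDefMatrixKernel {d m : ℕ}
    (C : EuclideanSpace ℝ (Fin d) → EuclideanSpace ℝ (Fin d) → Matrix (Fin m) (Fin m) ℝ) : Prop :=
  (∀ x y i j, C x y i j = C y x j i) ∧
  ∀ (n : ℕ) (x : Fin n → EuclideanSpace ℝ (Fin d)) (a : Fin n → Fin m → ℝ),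
    0 ≤ ∑ k, ∑ l, dotProduct (a k) (Matrix.mulVec (C (x k) (x l)) (a l))

/-- A positive definite matrix-valued function: the kernel `(x, y) ↦ C(x - y)` is positive
definite. -/
def IsPosDefMatrixFun {d m : ℕ}
    (C : EuclideanSpace ℝ (Fin d) → Matrix (Fin m) (Fin m) ℝ) : Prop :=
  IsPosDefMatrixKernel fun x y => C (x - y)

/-- An infinitely divisible positive definite matrix-valued function: `C` is positive definite
and, for every `n ≥ 1`, it is the componentwise `n`-th power of a positive definite
matrix-valued function. -/
def IsInfDivMatrixFun {d m : ℕ}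
    (C : EuclideanSpace ℝ (Fin d) → Matrix (Fin m) (Fin m) ℝ) : Prop :=
  IsPosDefMatrixFun C ∧
  ∀ n : ℕ, 1 ≤ n → ∃ D : EuclideanSpace ℝ (Fin d) → Matrix (Fin m) (Fin m) ℝ,
    IsPosDefMatrixFun D ∧ ∀ h i j, C h i j = (D h i j) ^ n

/-- `Γ` is the (stationary) pseudo cross-variogram of the `m`-variate random field `Z` on `ℝ^d`,
defined over the probability space `(Ω, P)`: all differences `Z_i(x) - Z_j(y)` are square
integrable, and `γ_ij(h) = Var(Z_i(x + h) - Z_j(x)) / 2` whatever `x` is. -/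
structure IsPseudoCrossVariogramOf {d m : ℕ} {Ω : Type*} [MeasurableSpace Ω] (P : Measure Ω)
    (Z : Fin m → EuclideanSpace ℝ (Fin d) → Ω → ℝ)
    (Γ : EuclideanSpace ℝ (Fin d) → Matrix (Fin m) (Fin m) ℝ) : Prop where
  measurable : ∀ i x, Measurable (Z i x)
  sq_integrable : ∀ i j x y, MemLp (fun ω => Z i x ω - Z j y ω) 2 P
  eq_variance : ∀ i j x h, Γ h i j = (1 / 2) * variance (fun ω => Z i (x + h) ω - Z j x ω) P

/-- `M(r) = max {|f z| : |z| = r}`. -/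
noncomputable def maxModulus (f : ℂ → ℂ) (r : ℝ) : ℝ :=
  sSup ((fun z => ‖f z‖) '' Metric.sphere (0 : ℂ) r)

/-- The order `limsup_{r → ∞} log log M(r) / log r` of an entire function, as an extended real
number (so that it is `⊤` for a function of infinite order). For a constant function the
quotients tend to `0`, and the order is `0`, as usual. -/
noncomputable def entireOrder (f : ℂ → ℂ) : EReal :=
  limsup (fun r : ℝ => ((Real.log (Real.log (maxModulus f r)) / Real.log r : ℝ) : EReal)) atTop

/-- `f` is an entire function taking real values on the reals, with `f(0) > 0`, `f'(0) = 0`,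
only purely imaginary zeros, and order less than `2`. -/
structure IsKosakiFun (f : ℂ → ℂ) : Prop where
  entire : Differentiable ℂ f
  real_on_real : ∀ x : ℝ, (f x).im = 0
  pos_zero : 0 < (f 0).re
  deriv_zero : deriv f 0 = 0
  zeros_imaginary : ∀ z, f z = 0 → z.re = 0
  order_lt_two : entireOrder f < 2

/-- `C_ij(h) = f(ν √γ_ij(h)) / f(√γ_ij(h))`, for `f` taking real values on the reals (whence the
real parts). -/
noncomputable def kosakiRatio {d m : ℕ} (f : ℂ → ℂ) (ν : ℝ)
    (Γ : EuclideanSpace ℝ (Fin d) → Matrix (Fin m) (Fin m) ℝ) :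
    EuclideanSpace ℝ (Fin d) → Matrix (Fin m) (Fin m) ℝ :=
  fun h => Matrix.of fun i j =>
    (f ((ν * Real.sqrt (Γ h i j) : ℝ) : ℂ)).re / (f ((Real.sqrt (Γ h i j) : ℝ) : ℂ)).re

/-! For `f` of order below 2 with `f'(0) = 0` and purely imaginary zeros, Hadamard's theorem would
give `f(z) = f(0) ∏ (1 + c_k z²)` with `c_k ≥ 0`. Hence `f(ν√γ) / f(√γ)` is a limit of products of
factors `(1 + ν² c γ) / (1 + c γ)`, and it is enough that each factor, raised entrywise to any power
`α ≥ 0`, is positive semidefinite; `α = 1/n` supplies the `n`-th root. The variogram is of negative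
type, `γ = v_a + v_b - K` with `K` a covariance (`exists_half_variance_sub_eq`), so Schoenberg's
theorem and a Laplace integral make `(1 + ν²cγ)⁻¹` positive semidefinite. The factor is `ν² / (1 -
(1 - ν²)(1 + ν²cγ)⁻¹)`, and `-log(1 - q)` and `exp` have nonnegative Taylor coefficients
(`ratio_rpow_entries`). The product is reached without infinite products (`exists_tendsto_prod`):
the zeros in a disc of radius `R` are divided out, and the logarithm of the zero-free remainder,
which vanishes to second order at 0, is `O(R^(s-2))` for some `s < 2`. -/

/-! ### Entrywise operations that preserve positive semidefiniteness. -/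

namespace Matrix

variable {ι : Type*} [Fintype ι]

theorem posSemidef_real_iff {M : Matrix ι ι ℝ} :
    M.PosSemidef ↔ (∀ a b, M a b = M b a) ∧ ∀ c : ι → ℝ, 0 ≤ ∑ a, ∑ b, c a * M a b * c b := by
  rw [posSemidef_iff_dotProduct_mulVec]
  refine and_congr ⟨fun h a b => ?_, fun h => ?_⟩ (forall_congr' fun c => ?_)
  · simpa using (h.apply b a)
  · ext a b
    simpa using h b a
  · simp [dotProduct, mulVec, Finset.mul_sum, mul_assoc]

theorem PosSemidef.of_tendsto {κ : Type*} {l : Filter κ} [l.NeBot] {F : κ → Matrix ι ι ℝ}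
    {M : Matrix ι ι ℝ} (hF : ∀ᶠ k in l, (F k).PosSemidef)
    (h : ∀ a b, Tendsto (fun k => F k a b) l (nhds (M a b))) : M.PosSemidef := by
  rw [posSemidef_real_iff]
  refine ⟨fun a b => ?_, fun c => ?_⟩
  · refine tendsto_nhds_unique_of_eventuallyEq (h a b) (h b a) ?_
    filter_upwards [hF] with k hk using (posSemidef_real_iff.1 hk).1 a b
  · refine ge_of_tendsto (x := l) (f := fun k => ∑ a, ∑ b, c a * F k a b * c b) ?_ ?_
    · exact tendsto_finsetSum _ fun a _ => tendsto_finsetSum _ fun b _ =>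
        ((h a b).const_mul _).mul_const _
    · filter_upwards [hF] with k hk using (posSemidef_real_iff.1 hk).2 c

theorem posSemidef_rankOne (v : ι → ℝ) : (of fun a b => v a * v b).PosSemidef := by
  rw [posSemidef_real_iff]
  refine ⟨fun a b => mul_comm _ _, fun c => ?_⟩
  have : ∑ a, ∑ b, c a * (of fun a b => v a * v b : Matrix ι ι ℝ) a b * c b
      = (∑ a, c a * v a) * ∑ b, c b * v b := by
    rw [Finset.sum_mul_sum]
    exact Finset.sum_congr rfl fun a _ => Finset.sum_congr rfl fun b _ => by
      simp only [of_apply]; ring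
  rw [this]
  exact mul_self_nonneg _

theorem posSemidef_const {r : ℝ} (hr : 0 ≤ r) : (of fun _ _ : ι => r).PosSemidef := by
  simpa [Real.mul_self_sqrt hr] using posSemidef_rankOne fun _ : ι => √r

omit [Fintype ι] in
theorem PosSemidef.mul_entries {A B : ι → ι → ℝ} (hA : (of A).PosSemidef) (hB : (of B).PosSemidef) :
    (of fun a b => A a b * B a b).PosSemidef :=
  hA.hadamard hB

theorem PosSemidef.prod_entries {κ : Type*} (s : Finset κ) {A : κ → ι → ι → ℝ}
    (hA : ∀ k ∈ s, (of (A k)).PosSemidef) :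
    (of fun a b => ∏ k ∈ s, A k a b).PosSemidef := by
  classical
  induction s using Finset.induction_on with
  | empty => simpa using posSemidef_const (ι := ι) zero_le_one
  | insert k s hk ih =>
    simp only [Finset.prod_insert hk]
    exact (hA k (by simp)).mul_entries (ih fun j hj => hA j (by simp [hj]))

theorem PosSemidef.pow_entries {A : ι → ι → ℝ} (hA : (of A).PosSemidef) (n : ℕ) :
    (of fun a b => A a b ^ n).PosSemidef := by
  simpa using prod_entries (Finset.range n) (A := fun _ => A) fun _ _ => hA

omit [Fintype ι] in
theorem PosSemidef.sum_entries {κ : Type*} (s : Finset κ) {A : κ → ι → ι → ℝ}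
    (hA : ∀ k ∈ s, (of (A k)).PosSemidef) :
    (of fun a b => ∑ k ∈ s, A k a b).PosSemidef := by
  convert posSemidef_sum s hA using 1
  ext a b
  simp [Matrix.sum_apply]

/-- A power series with nonnegative coefficients preserves positive semidefiniteness when applied
entrywise. -/
theorem PosSemidef.of_hasSum_pow {A B : ι → ι → ℝ} (hA : (of A).PosSemidef) {c : ℕ → ℝ}
    (hc : ∀ n, 0 ≤ c n) (h : ∀ a b, HasSum (fun n => c n * A a b ^ n) (B a b)) :
    (of B).PosSemidef := by
  refine PosSemidef.of_tendsto (l := atTop)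
    (F := fun N => of fun a b => ∑ n ∈ Finset.range N, c n * A a b ^ n) (.of_forall fun N => ?_)
    fun a b => (h a b).tendsto_sum_nat
  exact sum_entries _ fun n _ => (posSemidef_const (hc n)).mul_entries (hA.pow_entries n)

theorem PosSemidef.exp_entries {A : ι → ι → ℝ} (hA : (of A).PosSemidef) :
    (of fun a b => Real.exp (A a b)).PosSemidef := by
  refine hA.of_hasSum_pow (c := fun n => (n.factorial : ℝ)⁻¹) (fun n => by positivity) fun a b => ?_
  have := NormedSpace.expSeries_div_hasSum_exp (𝔸 := ℝ) (A a b)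
  rw [← Real.exp_eq_exp_ℝ] at this
  simpa [div_eq_inv_mul] using this

theorem PosSemidef.neg_log_one_sub_entries {A : ι → ι → ℝ} (hA : (of A).PosSemidef)
    (h : ∀ a b, |A a b| < 1) : (of fun a b => -Real.log (1 - A a b)).PosSemidef := by
  -- The coefficient at `n = 0` is `0⁻¹ = 0`, so the series has no constant term.
  refine hA.of_hasSum_pow (c := fun n => (n : ℝ)⁻¹) (fun n => by positivity) fun a b => ?_
  have := Real.hasSum_pow_div_log_of_abs_lt_one (h a b)
  rw [← hasSum_nat_add_iff' 1]
  simpa [div_eq_inv_mul] using this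

/-- Schoenberg: `exp (-γ)` is positive semidefinite if `γ a b = v a + v b - K a b` with `K`
positive semidefinite. -/
theorem PosSemidef.exp_neg_entries {K : ι → ι → ℝ} (hK : (of K).PosSemidef) (v : ι → ℝ) :
    (of fun a b => Real.exp (-(v a + v b - K a b))).PosSemidef := by
  convert (posSemidef_rankOne fun a => Real.exp (-v a)).mul_entries hK.exp_entries using 4
  rw [← Real.exp_add, ← Real.exp_add]
  ring_nf

/-- `(1 + s)⁻¹ = ∫₀^∞ exp(-(1 + s)u) du` is a mixture of Schoenberg kernels `exp(-us)` with positive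
weights `exp(-u)`. -/
theorem PosSemidef.one_add_inv_entries {K : ι → ι → ℝ} (hK : (of K).PosSemidef) (v : ι → ℝ)
    (hv : ∀ a b, 0 ≤ v a + v b - K a b) :
    (of fun a b => (1 + (v a + v b - K a b))⁻¹).PosSemidef := by
  have hint : ∀ a b, IntegrableOn (fun u : ℝ => Real.exp (-(1 + (v a + v b - K a b)) * u))
      (Set.Ioi 0) := fun a b =>
    (integrableOn_exp_mul_Ioi (by linarith [hv a b]) 0)
  have hval : ∀ a b, ∫ u in Set.Ioi (0 : ℝ), Real.exp (-(1 + (v a + v b - K a b)) * u)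
      = (1 + (v a + v b - K a b))⁻¹ := fun a b => by
    rw [integral_exp_mul_Ioi (by linarith [hv a b])]
    simp [neg_div_neg_eq, -neg_add_rev]
  have hpsd : ∀ u : ℝ, 0 < u →
      (of fun a b => Real.exp (-(1 + (v a + v b - K a b)) * u)).PosSemidef := fun u hu => by
    have hK' := (posSemidef_const (ι := ι) hu.le).mul_entries hK
    convert (posSemidef_const (ι := ι) (Real.exp_pos (-u)).le).mul_entries
      (hK'.exp_neg_entries fun a => u * v a) using 4
    rw [← Real.exp_add]
    ring_nf
  rw [posSemidef_real_iff]
  refine ⟨fun a b => ?_, fun c => ?_⟩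
  · have := (posSemidef_real_iff.1 hK).1 a b
    simp only [of_apply] at this ⊢
    rw [this, add_comm (v a)]
  · have : ∑ a, ∑ b, c a * (of fun a b => (1 + (v a + v b - K a b))⁻¹ : Matrix ι ι ℝ) a b * c b
        = ∫ u in Set.Ioi (0 : ℝ), ∑ a, ∑ b,
          c a * Real.exp (-(1 + (v a + v b - K a b)) * u) * c b := by
      rw [integral_finsetSum _ fun a _ => integrable_finsetSum _ fun b _ =>
        ((hint a b).const_mul _).mul_const _]
      refine Finset.sum_congr rfl fun a _ => ?_
      rw [integral_finsetSum _ fun b _ => ((hint a b).const_mul _).mul_const _]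
      refine Finset.sum_congr rfl fun b _ => ?_
      rw [integral_mul_const, integral_const_mul, hval, of_apply]
    rw [this]
    exact setIntegral_nonneg measurableSet_Ioi fun u hu =>
      (posSemidef_real_iff.1 (hpsd u hu)).2 c

/-- The kernel `(1 + ν² s) / (1 + s)`, with `s` of negative type, has positive semidefinite powers
of every nonnegative exponent. -/
theorem PosSemidef.ratio_rpow_entries {K : ι → ι → ℝ} (hK : (of K).PosSemidef) (v : ι → ℝ)
    (hv : ∀ a b, 0 ≤ v a + v b - K a b) {ν : ℝ} (hν : 0 < ν) (hν1 : ν ≤ 1) {α : ℝ} (hα : 0 ≤ α) :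
    (of fun a b => ((1 + ν ^ 2 * (v a + v b - K a b)) / (1 + (v a + v b - K a b))) ^ α).PosSemidef := by
  have hν2 : 0 < ν ^ 2 := by positivity
  have hν3 : ν ^ 2 ≤ 1 := pow_le_one₀ hν.le hν1
  have hq : (of fun a b => (1 + (ν ^ 2 * v a + ν ^ 2 * v b - ν ^ 2 * K a b))⁻¹).PosSemidef := by
    refine PosSemidef.one_add_inv_entries ((posSemidef_const hν2.le).mul_entries hK) _ fun a b => ?_
    have := mul_nonneg hν2.le (hv a b)
    linarith
  have hq' := (posSemidef_const (ι := ι) (sub_nonneg.2 hν3)).mul_entries hq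
  -- The entries lie in `[0, 1 - ν²]`, and `ν > 0` makes the bound by 1 strict.
  have hlog := hq'.neg_log_one_sub_entries fun a b => by
    have h0 := mul_nonneg hν2.le (hv a b)
    have h1 : (1 : ℝ) ≤ 1 + (ν ^ 2 * v a + ν ^ 2 * v b - ν ^ 2 * K a b) := by linarith
    have h2 := inv_le_one_of_one_le₀ h1
    have h3 : 0 < (1 + (ν ^ 2 * v a + ν ^ 2 * v b - ν ^ 2 * K a b))⁻¹ := by positivity
    rw [abs_of_nonneg (mul_nonneg (sub_nonneg.2 hν3) h3.le)]
    nlinarith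
  have := (posSemidef_const (ι := ι) (Real.rpow_nonneg hν2.le α)).mul_entries
    ((posSemidef_const (ι := ι) hα).mul_entries hlog).exp_entries
  convert this using 4 with a b
  have h0 := mul_nonneg hν2.le (hv a b)
  have hs := hv a b
  set s := v a + v b - K a b with hs_def
  have e1 : 1 + (ν ^ 2 * v a + ν ^ 2 * v b - ν ^ 2 * K a b) = 1 + ν ^ 2 * s := by
    rw [hs_def]; ring
  have hne : 1 + ν ^ 2 * s ≠ 0 := by positivity
  have e2 : (1 + ν ^ 2 * s) / (1 + s) = ν ^ 2 * (1 - (1 - ν ^ 2) * (1 + ν ^ 2 * s)⁻¹)⁻¹ := by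
    have : 1 - (1 - ν ^ 2) * (1 + ν ^ 2 * s)⁻¹ = ν ^ 2 * (1 + s) / (1 + ν ^ 2 * s) := by
      field_simp; ring
    rw [this]
    field_simp
  have h4 : 0 < 1 - (1 - ν ^ 2) * (1 + ν ^ 2 * s)⁻¹ := by
    have : 1 - (1 - ν ^ 2) * (1 + ν ^ 2 * s)⁻¹ = ν ^ 2 * (1 + s) / (1 + ν ^ 2 * s) := by
      field_simp; ring
    rw [this]
    positivity
  rw [e1]
  rw [e2, Real.mul_rpow hν2.le (by positivity), Real.rpow_def_of_pos (inv_pos.2 h4), Real.log_inv]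
  ring_nf

end Matrix

/-! ### Factorization of entire functions with imaginary zeros. -/

/-- A complex-valued entire function that is real on the real axis commutes with conjugation. -/
theorem Differentiable.map_conj_of_real {g : ℂ → ℂ} (hg : Differentiable ℂ g)
    (hr : ∀ x : ℝ, (g x).im = 0) (z : ℂ) : g (starRingEnd ℂ z) = starRingEnd ℂ (g z) := by
  have hd : Differentiable ℂ fun z => starRingEnd ℂ (g (starRingEnd ℂ z)) := fun z =>
    by
    have := (hg (starRingEnd ℂ z)).conj_conj
    rwa [Complex.conj_conj] at this
  have h1 : AnalyticOnNhd ℂ g Set.univ := fun z _ => hg.analyticAt z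
  have h2 : AnalyticOnNhd ℂ (fun z => starRingEnd ℂ (g (starRingEnd ℂ z))) Set.univ :=
    fun z _ => hd.analyticAt z
  have hreal : ∀ x : ℝ, g x = starRingEnd ℂ (g (starRingEnd ℂ x)) := fun x => by
    rw [Complex.conj_ofReal, Complex.conj_eq_iff_im.2 (hr x)]
  have key : g = fun z => starRingEnd ℂ (g (starRingEnd ℂ z)) := by
    refine h1.eq_of_frequently_eq (z₀ := 0) h2 ?_
    have ht : Tendsto (fun x : ℝ => (x : ℂ)) (nhdsWithin 0 {0}ᶜ) (nhdsWithin 0 {0}ᶜ) := by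
      refine tendsto_nhdsWithin_iff.2 ⟨?_, ?_⟩
      · exact (Complex.continuous_ofReal.tendsto' 0 0 (by simp)).mono_left nhdsWithin_le_nhds
      · filter_upwards [self_mem_nhdsWithin] with x hx
        simpa using hx
    exact ht.frequently (Eventually.of_forall hreal).frequently
  have := congrFun key (starRingEnd ℂ z)
  simpa using this

/-- A pair of conjugate purely imaginary zeros of an entire function can be split off. -/
theorem Differentiable.exists_eq_one_add_mul_sq_mul {g : ℂ → ℂ} (hg : Differentiable ℂ g)
    (hr : ∀ x : ℝ, (g x).im = 0) {z₀ : ℂ} (hz₀ : g z₀ = 0) (him : z₀.re = 0) (hne : z₀ ≠ 0) :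
    ∃ g₁ : ℂ → ℂ, Differentiable ℂ g₁ ∧ (∀ x : ℝ, (g₁ x).im = 0) ∧
      ∀ z, g z = (1 + ((‖z₀‖ ^ 2)⁻¹ : ℝ) * z ^ 2) * g₁ z := by
  have hconj : starRingEnd ℂ z₀ = -z₀ := by
    apply Complex.ext <;> simp [him]
  have hneg : g (-z₀) = 0 := by rw [← hconj, hg.map_conj_of_real hr, hz₀, map_zero]
  have hd : ∀ {u : ℂ → ℂ} (c : ℂ), Differentiable ℂ u → Differentiable ℂ (dslope u c) :=
    fun c hu => differentiableOn_univ.1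
      ((Complex.differentiableOn_dslope univ_mem).2 hu.differentiableOn)
  have hfac : ∀ {u : ℂ → ℂ} {c : ℂ}, u c = 0 → ∀ z, u z = (z - c) * dslope u c z :=
    fun {u c} hc z => by simpa [hc] using (sub_smul_dslope u c z).symm
  have h2z : -z₀ - z₀ ≠ 0 := by
    intro h
    apply hne
    have : (2 : ℂ) * z₀ = 0 := by linear_combination -h
    simpa using this
  have hneg' : dslope g z₀ (-z₀) = 0 := by
    have := hfac hz₀ (-z₀)
    rw [hneg] at this
    exact (mul_eq_zero.1 this.symm).resolve_left h2z
  have hsq : (‖z₀‖ ^ 2 : ℂ) = -z₀ ^ 2 := by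
    rw [← Complex.mul_conj', hconj]; ring
  have heq : ∀ z, g z = (1 + ((‖z₀‖ ^ 2)⁻¹ : ℝ) * z ^ 2) *
      ((-z₀ ^ 2) * dslope (dslope g z₀) (-z₀) z) := fun z => by
    rw [hfac hz₀ z, hfac hneg' z]
    push_cast
    rw [hsq]
    field_simp
    ring
  refine ⟨fun z => (-z₀ ^ 2) * dslope (dslope g z₀) (-z₀) z, (hd _ (hd _ hg)).const_mul _,
    fun x => ?_, heq⟩
  have h := heq x
  -- The split-off factor is a positive real on the real axis, so the cofactor is real there too.
  have hpos : 0 < 1 + (‖z₀‖ ^ 2)⁻¹ * x ^ 2 := by positivity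
  have him := hr x
  have hcast : (1 + ((‖z₀‖ ^ 2)⁻¹ : ℝ) * (x : ℂ) ^ 2) = ((1 + (‖z₀‖ ^ 2)⁻¹ * x ^ 2 : ℝ) : ℂ) := by
    push_cast; ring
  rw [h, hcast, Complex.im_ofReal_mul] at him
  exact (mul_eq_zero.1 him).resolve_left hpos.ne'

/-- `f z = ∏ k, (1 + c k * z ^ 2) * g z` with `g` entire and real on the real axis, where the zeros
of the product have modulus at most `R`. -/
structure IsPartialFactorization (f : ℂ → ℂ) (R : ℝ) {n : ℕ} (c : Fin n → ℝ) (g : ℂ → ℂ) :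
    Prop where
  differentiable : Differentiable ℂ g
  real_on_real : ∀ x : ℝ, (g x).im = 0
  le_coeff : ∀ k, (R ^ 2)⁻¹ ≤ c k
  eq_prod_mul : ∀ z, f z = (∏ k, (1 + (c k : ℂ) * z ^ 2)) * g z

theorem norm_le_maxModulus {f : ℂ → ℂ} (hf : Continuous f) (z : ℂ) :
    ‖f z‖ ≤ maxModulus f ‖z‖ := by
  refine le_csSup ?_ ⟨z, by simp, rfl⟩
  exact ((isCompact_sphere 0 _).image (hf.norm)).bddAbove

namespace IsPartialFactorization

variable {f g : ℂ → ℂ} {R : ℝ} {n : ℕ} {c : Fin n → ℝ}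

theorem map_zero (h : IsPartialFactorization f R c g) : g 0 = f 0 := by
  simp [h.eq_prod_mul]

/-- The factors are even, so dividing them out carries `f'(0) = 0` over to the cofactor. -/
theorem deriv_zero (h : IsPartialFactorization f R c g) : deriv g 0 = deriv f 0 := by
  have hP : HasDerivAt (fun z : ℂ => ∏ k, (1 + (c k : ℂ) * z ^ 2)) 0 0 := by
    have := HasDerivAt.fun_finsetProd (u := Finset.univ) (x := (0 : ℂ))
      (f := fun k z => 1 + (c k : ℂ) * z ^ 2) (f' := fun _ => 0) fun k _ => by
        simpa using ((hasDerivAt_pow 2 (0 : ℂ)).const_mul (c k : ℂ)).const_add 1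
    simpa using this
  have := hP.mul (h.differentiable 0).hasDerivAt
  rw [show f = (fun z : ℂ => ∏ k, (1 + (c k : ℂ) * z ^ 2)) * g from funext h.eq_prod_mul,
    this.deriv]
  simp

/-- On the circle of radius `2R` each factor has modulus at least `4 - 1 = 3`; the maximum principle
moves the bound inside. At `z = 0` it limits the number of factors, elsewhere it controls the
cofactor. -/
theorem three_pow_mul_norm_le (h : IsPartialFactorization f R c g) (hf : Continuous f) (hR : 0 < R)
    {z : ℂ} (hz : ‖z‖ ≤ 2 * R) : 3 ^ n * ‖g z‖ ≤ maxModulus f (2 * R) := by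
  have hsphere : ∀ w : ℂ, ‖w‖ = 2 * R → 3 ^ n * ‖g w‖ ≤ maxModulus f (2 * R) := fun w hw => by
    refine le_trans ?_ (hw ▸ norm_le_maxModulus hf w)
    rw [h.eq_prod_mul w, norm_mul, norm_prod]
    gcongr
    calc (3 : ℝ) ^ n = ∏ _k : Fin n, 3 := by simp
      _ ≤ ∏ k, ‖1 + (c k : ℂ) * w ^ 2‖ := by
        refine Finset.prod_le_prod (fun _ _ => by norm_num) fun k _ => ?_
        have h1 : 4 ≤ c k * (2 * R) ^ 2 := by
          have := mul_le_mul_of_nonneg_right (h.le_coeff k) (sq_nonneg (2 * R))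
          have e : (R ^ 2)⁻¹ * (2 * R) ^ 2 = 4 := by field_simp; norm_num
          linarith
        have hc : 0 ≤ c k := le_trans (by positivity) (h.le_coeff k)
        have h2 : ‖(c k : ℂ) * w ^ 2‖ = c k * (2 * R) ^ 2 := by
          rw [norm_mul, norm_pow, hw, Complex.norm_real, Real.norm_of_nonneg hc]
        have h3 := norm_sub_norm_le ((c k : ℂ) * w ^ 2) (-1)
        rw [sub_neg_eq_add, norm_neg, norm_one, h2, add_comm _ (1 : ℂ)] at h3
        linarith
  have := Complex.norm_le_of_forall_mem_frontier_norm_le (U := Metric.ball (0 : ℂ) (2 * R))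
    (C := maxModulus f (2 * R) / 3 ^ n) Metric.isBounded_ball
    (h.differentiable.diffContOnCl) (fun w hw => by
      rw [frontier_ball _ (by positivity), mem_sphere_zero_iff_norm] at hw
      rw [le_div_iff₀' (by positivity)]
      exact hsphere w hw) (z := z) (by
      rw [closure_ball _ (by positivity)]
      simpa using hz)
  rwa [le_div_iff₀' (by positivity)] at this

theorem exists_succ (h : IsPartialFactorization f R c g)
    (hf : ∀ z, f z = 0 → z.re = 0) (h0 : f 0 ≠ 0) {z₀ : ℂ} (hz₀ : g z₀ = 0) (hR : ‖z₀‖ ≤ R) :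
    ∃ (c' : Fin (n + 1) → ℝ) (g' : ℂ → ℂ), IsPartialFactorization f R c' g' := by
  have hne : z₀ ≠ 0 := by
    rintro rfl
    exact h0 (h.map_zero ▸ hz₀)
  obtain ⟨g₁, hd, hr, heq⟩ := h.differentiable.exists_eq_one_add_mul_sq_mul h.real_on_real hz₀
    (hf z₀ (by rw [h.eq_prod_mul, hz₀, mul_zero])) hne
  refine ⟨Fin.cons (‖z₀‖ ^ 2)⁻¹ c, g₁, hd, hr, fun k => ?_, fun z => ?_⟩
  · refine Fin.cases ?_ (fun k => ?_) k
    · simp only [Fin.cons_zero]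
      have : 0 < ‖z₀‖ := norm_pos_iff.2 hne
      gcongr
    · simpa using h.le_coeff k
  · rw [h.eq_prod_mul, heq, Fin.prod_univ_succ]
    simp only [Fin.cons_zero, Fin.cons_succ]
    ring

end IsPartialFactorization

/-- If zeros could be split off forever, `3 ^ n * ‖f 0‖ ≤ maxModulus f (2 * R)` would hold for all
`n`. -/
theorem exists_isPartialFactorization {f : ℂ → ℂ} (hf : Differentiable ℂ f)
    (hr : ∀ x : ℝ, (f x).im = 0) (him : ∀ z, f z = 0 → z.re = 0) (h0 : f 0 ≠ 0) {R : ℝ}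
    (hR : 0 < R) : ∃ (n : ℕ) (c : Fin n → ℝ) (g : ℂ → ℂ), IsPartialFactorization f R c g ∧
      ∀ z, ‖z‖ ≤ R → g z ≠ 0 := by
  by_contra! hcon
  have hall : ∀ n : ℕ, ∃ (c : Fin n → ℝ) (g : ℂ → ℂ), IsPartialFactorization f R c g := by
    intro n
    induction n with
    | zero => exact ⟨Fin.elim0, f, hf, hr, fun k => k.elim0, by simp⟩
    | succ n ih =>
      obtain ⟨c, g, h⟩ := ih
      obtain ⟨z₀, hz₀, hg⟩ := hcon n c g h
      exact h.exists_succ him h0 hg hz₀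
  obtain ⟨n, hn⟩ := pow_unbounded_of_one_lt (maxModulus f (2 * R) / ‖f 0‖) (by norm_num : (1 : ℝ) < 3)
  obtain ⟨c, g, h⟩ := hall n
  have := h.three_pow_mul_norm_le hf.continuous hR (z := 0) (by simpa using hR.le)
  rw [h.map_zero] at this
  rw [div_lt_iff₀ (norm_pos_iff.2 h0)] at hn
  linarith

/-- A zero-free holomorphic function with vanishing derivative at the centre has a logarithm whose
growth is controlled quadratically by the maximum of the function. -/
theorem exists_exp_eq_of_ne_zero {g : ℂ → ℂ} {R L : ℝ} (hR : 0 < R) (hL : 0 < L)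
    (hg : DifferentiableOn ℂ g (Metric.ball 0 R)) (hne : ∀ z ∈ Metric.ball (0 : ℂ) R, g z ≠ 0)
    (hd : deriv g 0 = 0) (hb : ∀ z ∈ Metric.ball (0 : ℂ) R, ‖g z‖ ≤ ‖g 0‖ * Real.exp L)
    {z : ℂ} (hz : ‖z‖ < R / 2) :
    ∃ w : ℂ, g z = g 0 * Complex.exp w ∧ ‖w‖ ≤ 2 * L * (‖z‖ / (R / 2)) ^ 2 := by
  have hmem : (0 : ℂ) ∈ Metric.ball (0 : ℂ) R := Metric.mem_ball_self hR
  have hg' : DifferentiableOn ℂ (deriv g) (Metric.ball 0 R) := hg.deriv Metric.isOpen_ball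
  obtain ⟨h, h0, hh⟩ := (hg'.div hg hne).isExactOn_ball.with_val_at 0 0
  have hgd : ∀ z ∈ Metric.ball (0 : ℂ) R, HasDerivAt g (deriv g z) z := fun z hz =>
    (hg.differentiableAt (Metric.isOpen_ball.mem_nhds hz)).hasDerivAt
  have hexp : ∀ z ∈ Metric.ball (0 : ℂ) R, g z = g 0 * Complex.exp (h z) := by
    have hconst : ∀ z ∈ Metric.ball (0 : ℂ) R,
        HasDerivAt (fun z => g z * Complex.exp (-h z)) 0 z := fun z hz => by
      have h2 : HasDerivAt h (deriv g z / g z) z := hh z hz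
      have := (hgd z hz).mul h2.neg.cexp
      have hgz := hne z hz
      have e : g z * (Complex.exp (-h z) * -(deriv g z / g z)) = -(deriv g z * Complex.exp (-h z)) := by
        field_simp
      simp only [Pi.neg_apply] at this
      rw [e, add_neg_cancel] at this
      exact this
    intro z hz
    have := Metric.isOpen_ball.is_const_of_deriv_eq_zero
      (convex_ball (0 : ℂ) R).isPreconnected
      (fun z hz => (hconst z hz).differentiableAt.differentiableWithinAt)
      (fun z hz => (hconst z hz).deriv) hz hmem
    simp only [h0, neg_zero, Complex.exp_zero, mul_one] at this
    rw [← this, mul_assoc, ← Complex.exp_add]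
    simp
  have hg0 : 0 < ‖g 0‖ := norm_pos_iff.2 (hne 0 hmem)
  have hhd : DifferentiableOn ℂ h (Metric.ball 0 R) := fun z hz =>
    (hh z hz).differentiableAt.differentiableWithinAt
  have hre : Set.MapsTo h (Metric.ball 0 R) {z | z.re ≤ L} := fun z hz => by
    have := hb z hz
    rw [hexp z hz, norm_mul, Complex.norm_exp] at this
    exact Real.exp_le_exp.1 (le_of_mul_le_mul_left this hg0)
  have hz' : z ∈ Metric.ball (0 : ℂ) (R / 2) := by simpa using hz
  have hsub : Metric.ball (0 : ℂ) (R / 2) ⊆ Metric.ball 0 R :=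
    Metric.ball_subset_ball (by linarith)
  refine ⟨h z, hexp z (hsub hz'), ?_⟩
  -- Borel–Carathéodory: `Re h ≤ L` on the ball of radius `R` gives `‖h‖ ≤ 2L` on the half-radius
  -- ball.
  have hmaps : Set.MapsTo h (Metric.ball 0 (R / 2)) (Metric.closedBall (h 0) (2 * L)) := by
    intro w hw
    rw [h0, mem_closedBall_zero_iff]
    refine (Complex.borelCaratheodory_zero hL hhd hre hR (hsub hw) h0).trans ?_
    have hw' : ‖w‖ < R / 2 := by simpa using hw
    rw [div_le_iff₀ (by linarith)]
    gcongr
    linarith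
  -- Since `h'(0) = 0`, the Schwarz lemma applies to second order and yields the square.
  have hlit : (h · - h 0) =o[nhds 0] (fun w : ℂ => ‖w - 0‖ ^ 1) := by
    have h2 : HasDerivAt h (deriv g 0 / g 0) 0 := hh 0 hmem
    rw [hd, zero_div, hasDerivAt_iff_isLittleO] at h2
    simpa using h2.norm_right
  have := Complex.dist_le_mul_div_pow_of_mapsTo_ball_of_isLittleO (hhd.mono hsub) hmaps hlit hz'
  simpa [h0] using this

theorem exists_log_maxModulus_le_rpow {f : ℂ → ℂ} (hf : entireOrder f < 2) :
    ∃ c : ℝ, c < 2 ∧ ∀ᶠ r in atTop, Real.log (maxModulus f r) ≤ r ^ c := by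
  obtain ⟨c, hc1, hc2⟩ := EReal.exists_between_coe_real hf
  refine ⟨c, EReal.coe_lt_coe_iff.1 hc2, ?_⟩
  filter_upwards [eventually_lt_of_limsup_lt hc1, eventually_gt_atTop 1] with r hr hr1
  have hr' : Real.log (Real.log (maxModulus f r)) < c * Real.log r := by
    rwa [EReal.coe_lt_coe_iff, div_lt_iff₀ (Real.log_pos hr1)] at hr
  -- The iterated real logarithm is informative only when the inner one is positive; otherwise the
  -- bound is trivial.
  rcases le_or_gt (Real.log (maxModulus f r)) 0 with h | h
  · exact h.trans (by positivity)
  · rw [Real.rpow_def_of_pos (by linarith), mul_comm, ← Real.log_le_iff_le_exp h]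
    exact hr'.le

/-- An entire function as in `IsKosakiFun` is a pointwise limit of polynomials
`f 0 * ∏ k, (1 + c k * z ^ 2)` with nonnegative `c k`. -/
theorem IsKosakiFun.exists_tendsto_prod {f : ℂ → ℂ} (hf : IsKosakiFun f) :
    ∃ (n : ℕ → ℕ) (c : ∀ N, Fin (n N) → ℝ), (∀ N k, 0 ≤ c N k) ∧
      ∀ z : ℂ, Tendsto (fun N => f 0 * ∏ k, (1 + (c N k : ℂ) * z ^ 2)) atTop (nhds (f z)) := by
  have h0 : f 0 ≠ 0 := fun h => by simpa [h] using hf.pos_zero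
  have hR : ∀ N : ℕ, (0 : ℝ) < N + 1 := fun N => by positivity
  choose n c g hfac hne using fun N : ℕ => exists_isPartialFactorization hf.entire
    hf.real_on_real hf.zeros_imaginary h0 (hR N)
  refine ⟨n, c, fun N k => le_trans (by positivity) ((hfac N).le_coeff k), fun z => ?_⟩
  obtain ⟨s, hs, hev⟩ := exists_log_maxModulus_le_rpow hf.order_lt_two
  have htop : Tendsto (fun N : ℕ => 2 * ((N : ℝ) + 1)) atTop atTop :=
    (tendsto_atTop_add_const_right _ _ tendsto_natCast_atTop_atTop).const_mul_atTop two_pos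
  -- `K` absorbs `-log ‖f 0‖`, and the added 1 keeps `L = (2R)^s + K` positive. With `R = N + 1`,
  -- the bound `2L(‖z‖/(R/2))²` equals `32‖z‖² L/(2R)²`.
  set K : ℝ := |Real.log ‖f 0‖| + 1 with hK
  have hw : ∀ᶠ N : ℕ in atTop, ∃ w : ℂ, g N z = f 0 * Complex.exp w ∧
      ‖w‖ ≤ 32 * ‖z‖ ^ 2 * (((2 * ((N : ℝ) + 1)) ^ s + K) * ((2 * ((N : ℝ) + 1)) ^ 2)⁻¹) := by
    filter_upwards [htop.eventually hev, htop.eventually_gt_atTop (4 * ‖z‖)] with N hN hNz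
    have hL : 0 < (2 * ((N : ℝ) + 1)) ^ s + K := by positivity
    have hM : 0 < maxModulus f (2 * ((N : ℝ) + 1)) := by
      have := (hfac N).three_pow_mul_norm_le hf.entire.continuous (hR N) (z := 0)
        (by simpa using (hR N).le)
      rw [(hfac N).map_zero] at this
      exact lt_of_lt_of_le (by positivity) this
    obtain ⟨w, hw1, hw2⟩ := exists_exp_eq_of_ne_zero (g := g N) (hR N) hL
      (hfac N).differentiable.differentiableOn
      (fun z hz => hne N z (by simpa using (Metric.mem_ball.1 hz).le))
      ((hfac N).deriv_zero.trans hf.deriv_zero) (fun w hw => by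
        have h1 := (hfac N).three_pow_mul_norm_le hf.entire.continuous (hR N) (z := w)
          (by have : ‖w‖ < N + 1 := by simpa using hw
              linarith [hR N])
        have h2 : ‖g N w‖ ≤ 3 ^ n N * ‖g N w‖ :=
          le_mul_of_one_le_left (norm_nonneg _) (one_le_pow₀ (by norm_num))
        rw [(hfac N).map_zero]
        have hf0 : 0 < ‖f 0‖ := norm_pos_iff.2 h0
        refine (h2.trans h1).trans ?_
        rw [← Real.log_le_log_iff hM (by positivity), Real.log_mul hf0.ne' (Real.exp_ne_zero _),
          Real.log_exp]
        linarith [neg_abs_le (Real.log ‖f 0‖)]) (z := z) (by linarith)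
    refine ⟨w, by rw [hw1, (hfac N).map_zero], hw2.trans (le_of_eq ?_)⟩
    have := (hR N).ne'
    field_simp
    ring
  have hlim : Tendsto (fun N : ℕ => 32 * ‖z‖ ^ 2 *
      (((2 * ((N : ℝ) + 1)) ^ s + K) * ((2 * ((N : ℝ) + 1)) ^ 2)⁻¹)) atTop (nhds 0) := by
    have hr : Tendsto (fun r : ℝ => 32 * ‖z‖ ^ 2 * (r ^ (-(2 - s)) + K * (r ^ 2)⁻¹)) atTop
        (nhds (32 * ‖z‖ ^ 2 * (0 + K * 0))) :=
      ((tendsto_rpow_neg_atTop (by linarith)).add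
        ((tendsto_inv_atTop_zero.comp (tendsto_pow_atTop two_ne_zero)).const_mul K)).const_mul _
    have := hr.comp htop
    simp only [mul_zero, add_zero] at this
    refine this.congr fun N => ?_
    have hpos : (0 : ℝ) < 2 * (N + 1) := by positivity
    have e : (2 * ((N : ℝ) + 1)) ^ (-(2 - s)) = (2 * ((N : ℝ) + 1)) ^ s * ((2 * ((N : ℝ) + 1)) ^ 2)⁻¹ := by
      rw [neg_sub, Real.rpow_sub hpos, Real.rpow_two, div_eq_mul_inv]
    simp only [Function.comp]
    rw [e]
    ring
  obtain ⟨w, hspec⟩ := hw.choice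
  have hw0 : Tendsto w atTop (nhds 0) :=
    squeeze_zero_norm' (hspec.mono fun N h => h.2) hlim
  -- `f z * exp(-w N)` is eventually the polynomial `f 0 * ∏ k, (1 + c N k * z ^ 2)`.
  have hfin : Tendsto (fun N => f z * Complex.exp (-w N)) atTop (nhds (f z)) := by
    have := ((Complex.continuous_exp.tendsto _).comp hw0.neg).const_mul (f z)
    simpa using this
  refine hfin.congr' ?_
  filter_upwards [hspec] with N hN
  rw [(hfac N).eq_prod_mul z, hN.1, Complex.exp_neg]
  have := Complex.exp_ne_zero (w N)
  rw [← mul_assoc, mul_inv_cancel_right₀ this, mul_comm]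

/-! ### Pseudo cross-variograms and infinite divisibility. -/

open Matrix in
theorem isPosDefMatrixFun_of_posSemidef {d m : ℕ}
    {C : EuclideanSpace ℝ (Fin d) → Matrix (Fin m) (Fin m) ℝ}
    (h : ∀ (n : ℕ) (x : Fin n → EuclideanSpace ℝ (Fin d)),
      (of fun p q : Fin n × Fin m => C (x p.1 - x q.1) p.2 q.2).PosSemidef) :
    IsPosDefMatrixFun C := by
  refine ⟨fun x y i j => ?_, fun n x a => ?_⟩
  · simpa using (posSemidef_real_iff.1 (h 2 ![x, y])).1 (0, i) (1, j)
  · refine ((posSemidef_real_iff.1 (h n x)).2 fun p => a p.1 p.2).trans_eq ?_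
    simp only [Fintype.sum_prod_type, of_apply, dotProduct, mulVec, Finset.mul_sum, mul_assoc]
    exact Finset.sum_congr rfl fun k _ => Finset.sum_comm

open Matrix in
/-- Variances of differences of square integrable differences are of negative type. -/
theorem exists_half_variance_sub_eq {Ω ι : Type*} [MeasurableSpace Ω] {P : Measure Ω}
    [IsProbabilityMeasure P] [Fintype ι] {X : ι → Ω → ℝ}
    (hX : ∀ a b, MemLp (fun ω => X a ω - X b ω) 2 P) :
    ∃ (K : ι → ι → ℝ) (v : ι → ℝ), (of K).PosSemidef ∧
      ∀ a b, (1 / 2) * variance (fun ω => X a ω - X b ω) P = v a + v b - K a b := by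
  rcases isEmpty_or_nonempty ι with hι | ⟨⟨o⟩⟩
  · exact ⟨fun _ _ => 0, fun _ => 0, posSemidef_const le_rfl, fun a => (hι.false a).elim⟩
  -- Only differences are square integrable, so the fields are recentred at a base index `o`; this
  -- leaves the differences unchanged.
  set Y : ι → Ω → ℝ := fun a ω => X a ω - X o ω with hY
  have hYL : ∀ a, MemLp (Y a) 2 P := fun a => hX a o
  refine ⟨fun a b => covariance (Y a) (Y b) P, fun a => (1 / 2) * variance (Y a) P, ?_,
    fun a b => ?_⟩
  · refine posSemidef_real_iff.2 ⟨fun a b => covariance_comm _ _, fun c => ?_⟩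
    have hcY : ∀ a, MemLp (fun ω => c a * Y a ω) 2 P := fun a => (hYL a).const_mul _
    have : ∑ a, ∑ b, c a * (of fun a b => covariance (Y a) (Y b) P : Matrix ι ι ℝ) a b * c b
        = variance (fun ω => ∑ a, c a * Y a ω) P := by
      rw [← covariance_self (memLp_finsetSum _ fun a _ => hcY a).aemeasurable,
        covariance_fun_sum_fun_sum hcY hcY]
      refine Finset.sum_congr rfl fun a _ => Finset.sum_congr rfl fun b _ => ?_
      rw [covariance_const_mul_left, covariance_const_mul_right, of_apply]
      ring
    rw [this]
    exact variance_nonneg _ _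
  · have : (fun ω => X a ω - X b ω) = fun ω => Y a ω - Y b ω := by
      funext ω
      simp [hY]
    have hab : MemLp (fun ω => Y a ω - Y b ω) 2 P := (hYL a).sub (hYL b)
    rw [this, ← covariance_self hab.aemeasurable,
      covariance_fun_sub_fun_sub (hYL a) (hYL b) (hYL a) (hYL b), covariance_self (hYL a).aemeasurable,
      covariance_self (hYL b).aemeasurable, covariance_comm (Y b)]
    ring

namespace IsKosakiFun

variable {f : ℂ → ℂ}

theorem exists_tendsto_re (hf : IsKosakiFun f) :
    ∃ (n : ℕ → ℕ) (c : ∀ N, Fin (n N) → ℝ), (∀ N k, 0 ≤ c N k) ∧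
      ∀ x : ℝ, Tendsto (fun N => (f 0).re * ∏ k, (1 + c N k * x ^ 2)) atTop
        (nhds (f x).re) := by
  obtain ⟨n, c, hc, h⟩ := hf.exists_tendsto_prod
  refine ⟨n, c, hc, fun x => ?_⟩
  refine ((Complex.continuous_re.tendsto _).comp (h x)).congr fun N => ?_
  have : (∏ k, (1 + (c N k : ℂ) * (x : ℂ) ^ 2)) = ((∏ k, (1 + c N k * x ^ 2) : ℝ) : ℂ) := by
    push_cast; rfl
  simp only [Function.comp, this, Complex.re_mul_ofReal]

/-- The approximating products are at least 1 on the real axis, so `f x ≥ f 0 > 0` there. -/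
theorem re_pos (hf : IsKosakiFun f) (x : ℝ) : 0 < (f x).re := by
  obtain ⟨n, c, hc, h⟩ := hf.exists_tendsto_re
  refine hf.pos_zero.trans_le (ge_of_tendsto (h x) (.of_forall fun N => ?_))
  refine le_mul_of_one_le_right hf.pos_zero.le ?_
  refine Finset.prod_induction _ (1 ≤ ·) (fun _ _ => one_le_mul_of_one_le_of_one_le) le_rfl
    fun k _ => ?_
  have := mul_nonneg (hc N k) (sq_nonneg x)
  linarith

open Matrix in
theorem posSemidef_ratio_rpow {ι : Type*} [Fintype ι] (hf : IsKosakiFun f) {K : ι → ι → ℝ}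
    (hK : (of K).PosSemidef) (v : ι → ℝ) (hv : ∀ a b, 0 ≤ v a + v b - K a b) {ν : ℝ}
    (hν : ν ∈ Set.Icc (0 : ℝ) 1) {α : ℝ} (hα : 0 ≤ α) :
    (of fun a b => ((f ((ν * √(v a + v b - K a b) : ℝ) : ℂ)).re /
      (f ((√(v a + v b - K a b) : ℝ) : ℂ)).re) ^ α).PosSemidef := by
  have hpos : ∀ ν : ℝ, 0 < ν → ν ≤ 1 →
      (of fun a b => ((f ((ν * √(v a + v b - K a b) : ℝ) : ℂ)).re /
        (f ((√(v a + v b - K a b) : ℝ) : ℂ)).re) ^ α).PosSemidef := by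
    intro ν h0 h1
    obtain ⟨n, c, hc, h⟩ := hf.exists_tendsto_re
    refine PosSemidef.of_tendsto (l := atTop)
      (F := fun N => of fun a b => ∏ k, ((1 + ν ^ 2 * (c N k * v a + c N k * v b - c N k * K a b)) /
        (1 + (c N k * v a + c N k * v b - c N k * K a b))) ^ α) (.of_forall fun N => ?_)
      fun a b => ?_
    · refine PosSemidef.prod_entries _ fun k _ => PosSemidef.ratio_rpow_entries
        ((posSemidef_const (hc N k)).mul_entries hK) (fun a => c N k * v a) (fun a b => ?_) h0 h1 hα
      have := mul_nonneg (hc N k) (hv a b)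
      linarith
    · have hlim := ((h (ν * √(v a + v b - K a b))).div (h (√(v a + v b - K a b)))
        (hf.re_pos _).ne').rpow_const (p := α) (Or.inr hα)
      refine hlim.congr fun N => ?_
      have hs := fun k => mul_nonneg (hc N k) (hv a b)
      have e : ∀ k, c N k * v a + c N k * v b - c N k * K a b = c N k * (v a + v b - K a b) :=
        fun k => by ring
      simp only [Pi.div_apply, of_apply, e, mul_pow, Real.sq_sqrt (hv a b)]
      rw [mul_div_mul_left _ _ hf.pos_zero.ne', ← Finset.prod_div_distrib,
        Real.finsetProd_rpow _ _ fun k _ => ?_]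
      · congr 1
        exact Finset.prod_congr rfl fun k _ => by rw [mul_left_comm]
      · have := hs k
        positivity
  -- The factor argument needs `ν > 0`; the case `ν = 0` is a limit from the right.
  rcases hν.1.eq_or_lt with rfl | h0
  · refine PosSemidef.of_tendsto (l := nhdsWithin (0 : ℝ) (Set.Ioi 0))
      (F := fun ν => of fun a b => ((f ((ν * √(v a + v b - K a b) : ℝ) : ℂ)).re /
        (f ((√(v a + v b - K a b) : ℝ) : ℂ)).re) ^ α) ?_ fun a b => ?_
    · filter_upwards [Ioc_mem_nhdsGT (zero_lt_one' ℝ)] with ν hν using hpos ν hν.1 hν.2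
    · have hfc := hf.entire.continuous
      have : Continuous fun ν : ℝ => ((f ((ν * √(v a + v b - K a b) : ℝ) : ℂ)).re /
          (f ((√(v a + v b - K a b) : ℝ) : ℂ)).re) ^ α := by
        refine Continuous.rpow_const ?_ fun _ => Or.inr hα
        fun_prop
      exact (this.tendsto 0).mono_left nhdsWithin_le_nhds
  · exact hpos ν h0 hν.2

end IsKosakiFun

theorem IsKosakiFun.isInfDivMatrixFun_kosakiRatio {d m : ℕ} {Ω : Type*} [MeasurableSpace Ω]
    {P : Measure Ω} [IsProbabilityMeasure P] {Z : Fin m → EuclideanSpace ℝ (Fin d) → Ω → ℝ}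
    {Γ : EuclideanSpace ℝ (Fin d) → Matrix (Fin m) (Fin m) ℝ}
    (hΓ : IsPseudoCrossVariogramOf P Z Γ) {f : ℂ → ℂ} (hf : IsKosakiFun f) {ν : ℝ}
    (hν : ν ∈ Set.Icc (0 : ℝ) 1) : IsInfDivMatrixFun (kosakiRatio f ν Γ) := by
  have key : ∀ α : ℝ, 0 ≤ α →
      IsPosDefMatrixFun fun h => Matrix.of fun i j => kosakiRatio f ν Γ h i j ^ α := by
    intro α hα
    refine isPosDefMatrixFun_of_posSemidef fun n x => ?_
    obtain ⟨K, v, hK, hv⟩ := exists_half_variance_sub_eq (P := P)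
      (X := fun p : Fin n × Fin m => Z p.2 (x p.1)) fun a b => hΓ.sq_integrable _ _ _ _
    -- Stationarity, used at the base point `x q.1`, turns the value at a difference into a variance
    -- between two points.
    have hγ : ∀ p q : Fin n × Fin m, Γ (x p.1 - x q.1) p.2 q.2 = v p + v q - K p q := fun p q => by
      rw [hΓ.eq_variance p.2 q.2 (x q.1), add_sub_cancel, hv]
    have := hf.posSemidef_ratio_rpow hK v
      (fun a b => by rw [← hv]; exact mul_nonneg (by norm_num) (variance_nonneg _ _)) hν hα
    simpa only [kosakiRatio, Matrix.of_apply, hγ] using this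
  have hpos : ∀ h i j, 0 ≤ kosakiRatio f ν Γ h i j := fun h i j =>
    (div_pos (hf.re_pos _) (hf.re_pos _)).le
  refine ⟨?_, fun n hn => ⟨_, key (n : ℝ)⁻¹ (by positivity), fun h i j => ?_⟩⟩
  · convert key 1 zero_le_one using 3
    simp [kosakiRatio]
  · rw [Matrix.of_apply, Real.rpow_inv_natCast_pow (hpos h i j) (by omega)]

/-! ### The hyperbolic cosine. -/

theorem maxModulus_cosh_le {r : ℝ} (hr : 0 ≤ r) : maxModulus Complex.cosh r ≤ Real.exp r := by
  refine csSup_le ((NormedSpace.sphere_nonempty.2 hr).image _) ?_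
  rintro _ ⟨z, hz, rfl⟩
  rw [mem_sphere_zero_iff_norm] at hz
  have h1 : ‖Complex.exp z‖ ≤ Real.exp r := hz ▸ Complex.norm_exp_le_exp_norm z
  have h2 : ‖Complex.exp (-z)‖ ≤ Real.exp r := by
    simpa [hz] using Complex.norm_exp_le_exp_norm (-z)
  have h3 : Complex.cosh z = (Complex.exp z + Complex.exp (-z)) / 2 := rfl
  simp only [h3]
  rw [norm_div, Complex.norm_ofNat, div_le_iff₀ two_pos]
  linarith [norm_add_le (Complex.exp z) (Complex.exp (-z))]

/-- Makes `log M(r)` positive, so that the outer logarithm in the order is monotone on the values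
compared. -/
theorem one_lt_maxModulus_cosh {r : ℝ} (hr : 0 < r) : 1 < maxModulus Complex.cosh r := by
  have := norm_le_maxModulus Complex.continuous_cosh (r : ℂ)
  rw [← Complex.ofReal_cosh, Complex.norm_real, Complex.norm_real, Real.norm_of_nonneg hr.le,
    Real.norm_of_nonneg (Real.cosh_pos r).le] at this
  exact (Real.one_lt_cosh.2 hr.ne').trans_le this

theorem entireOrder_cosh_le_one : entireOrder Complex.cosh ≤ 1 := by
  refine limsup_le_of_le (by isBoundedDefault) ?_
  filter_upwards [eventually_gt_atTop 1] with r hr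
  have hr0 : 0 < r := by linarith
  have hM := one_lt_maxModulus_cosh hr0
  have h1 : Real.log (maxModulus Complex.cosh r) ≤ r := by
    rw [Real.log_le_iff_le_exp (by linarith)]
    exact maxModulus_cosh_le hr0.le
  have h2 : Real.log (Real.log (maxModulus Complex.cosh r)) ≤ Real.log r :=
    Real.log_le_log (Real.log_pos hM) h1
  exact EReal.coe_le_coe_iff.2 ((div_le_one (Real.log_pos hr)).2 h2)

theorem isKosakiFun_cosh : IsKosakiFun Complex.cosh where
  entire := Complex.differentiable_cosh
  real_on_real := Complex.cosh_ofReal_im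
  pos_zero := by simp
  deriv_zero := by simp
  zeros_imaginary := fun z hz => by
    have h : Complex.exp z = -Complex.exp (-z) := by
      have h3 : Complex.cosh z = (Complex.exp z + Complex.exp (-z)) / 2 := rfl
      rw [h3] at hz
      linear_combination 2 * hz
    have := congrArg norm h
    rw [norm_neg, Complex.norm_exp, Complex.norm_exp, Complex.neg_re, Real.exp_eq_exp] at this
    linarith
  order_lt_two := entireOrder_cosh_le_one.trans_lt (by norm_num)

theorem mainTheorem3 {d m : ℕ} {Ω : Type*} [MeasurableSpace Ω]
    (P : Measure Ω) [IsProbabilityMeasure P]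
    (Z : Fin m → EuclideanSpace ℝ (Fin d) → Ω → ℝ)
    (Γ : EuclideanSpace ℝ (Fin d) → Matrix (Fin m) (Fin m) ℝ)
    (hΓ : IsPseudoCrossVariogramOf P Z Γ) :
    (∀ f : ℂ → ℂ, IsKosakiFun f →
      (∀ h i j, f ((Real.sqrt (Γ h i j) : ℝ) : ℂ) ≠ 0) ∧
      ∀ ν ∈ Set.Icc (0 : ℝ) 1, IsInfDivMatrixFun (kosakiRatio f ν Γ)) ∧
    IsKosakiFun Complex.cosh ∧
    ∀ ν ∈ Set.Icc (0 : ℝ) 1,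
      IsInfDivMatrixFun (fun h => Matrix.of fun i j =>
        Real.cosh (ν * Real.sqrt (Γ h i j)) / Real.cosh (Real.sqrt (Γ h i j))) := by
  refine ⟨fun f hf => ⟨fun h i j h0 => ?_, fun ν hν => hf.isInfDivMatrixFun_kosakiRatio hΓ hν⟩,
    isKosakiFun_cosh, fun ν hν => ?_⟩
  · have := hf.re_pos (√(Γ h i j))
    simp [h0] at this
  · convert isKosakiFun_cosh.isInfDivMatrixFun_kosakiRatio hΓ hν using 5
    simp only [kosakiRatio, Complex.cosh_ofReal_re]
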